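/- For integers $r \ge 2$ and $n \ge 1$, let $p_r(n)$ denote the probability that a uniformly random permutation $\sigma$ of $\{1,\dots,n\}$ has an $r$-th root, i.e. that there is a permutation $\pi$ of $\{1,\dots,n\}$ with $\pi^r=\sigma$. Let $q$ be a prime, $l \ge 1$ an integer, $r = q^l$, and let $n$ be a positive integer. (i) If $q \mid n+1$ but $qr \nmid n+1$, then $$p_r(n) \ \ge\ \frac{n+1}{n}\, p_r(n+1),$$ with equality if and only if $n+1 = kq$ for some $k \in \{1,2,\dots,r-1\}$. (ii) If $qr \mid n+1$, then $p_r(n) \ge p_r(n+1)$, with equality if and only if $r = 2$ and $n = 3$. -/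

import Mathlib

/-- A permutation `σ` has an `r`-th root if `π ^ r = σ` for some permutation `π`
of the same set. -/
def HasPermRoot (r : ℕ) {α : Type*} (σ : Equiv.Perm α) : Prop :=
  ∃ π : Equiv.Perm α, π ^ r = σ

/-- The probability `p_r(n)` that a uniformly random permutation of an `n`-element set
has an `r`-th root. -/
noncomputable def rootProb (r n : ℕ) : ℝ :=
  (Nat.card {σ : Equiv.Perm (Fin n) // HasPermRoot r σ} : ℝ) /
    (Nat.card (Equiv.Perm (Fin n)) : ℝ)

/-! Write `r = q ^ l`. A permutation has an `r`-th root iff, for each length divisible by `q`, the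
number of its cycles of that length is a multiple of `r` (`hasPermRoot_prime_pow_iff`). Separating
cycle lengths by divisibility by `q` factors the generating function of `p_r`. The factor of lengths
prime to `q` has `n`-th coefficient `u (n / q)`, with `u = binomCoeff q` and floor division; the
other factor lives on multiples of `q * r`, with values `d i = fullProb q r (q * r * i) > 0`. Hence
`p_r(n) = ∑ i, d i * u (n / q - r * i)` (`rootProb_eq_sum`).

In case (i), write `n + 1 = q * m`. The sums for `n` and `n + 1` have the same range, and the
inequality holds termwise: the `i`-th difference is a positive multiple of `r * i`. Equality thus
means that only `i = 0` occurs, that is `m < r`.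

In case (ii), write `n + 1 = q * r * s`. The sum for `n + 1` gains the term `d s`, which must be
outweighed by the decrease of `u` in the others. Counting points in `r` equal cycles bounds `d s` by
a combination of the `d (s - j)` (`mul_fullProb_mul_le`), and its weights are compared with `u (r *
j - 1)`. The comparison is strict for `r ≥ 3`; for `r = 2` it is sharp at `j = 1`, which leaves only
`s = 1`, `n = 3`. -/

/-! ### Cycle types and pointwise periods -/

open Function in
theorem minimalPeriod_eq_card_support_cycleOf {α : Type*} [Fintype α] [DecidableEq α]
    (σ : Equiv.Perm α) {x : α} (hx : σ x ≠ x) :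
    minimalPeriod σ x = (σ.cycleOf x).support.card := by
  have key : ∀ n : ℕ, minimalPeriod σ x ∣ n ↔ (σ.cycleOf x).support.card ∣ n := by
    intro n
    rw [← isPeriodicPt_iff_minimalPeriod_dvd, IsPeriodicPt, IsFixedPt,
      ← Equiv.Perm.coe_pow]
    exact (σ.isCycleOn_support_cycleOf x).pow_apply_eq
      ((Equiv.Perm.mem_support_cycleOf_iff' hx).2 (Equiv.Perm.SameCycle.refl _ _))
  exact Nat.dvd_antisymm ((key _).2 dvd_rfl) ((key _).1 dvd_rfl)

open Function in
-- Pointwise periods behave simply under powers, so counting points by period reads off the cycle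
-- type of a power.
theorem card_filter_minimalPeriod_eq {α : Type*} [Fintype α] [DecidableEq α]
    (σ : Equiv.Perm α) {i : ℕ} (hi : 2 ≤ i) :
    (Finset.univ.filter fun x => minimalPeriod σ x = i).card = i * σ.cycleType.count i := by
  have hne : ∀ x, minimalPeriod σ x = i → σ x ≠ x := by
    intro x hx h
    rw [minimalPeriod_eq_one_iff_isFixedPt.2 h] at hx
    omega
  have hset : (Finset.univ.filter fun x => minimalPeriod σ x = i) =
      (σ.cycleFactorsFinset.filter fun c => c.support.card = i).biUnion
        fun c => c.support := by
    ext x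
    simp only [Finset.mem_filter, Finset.mem_univ, true_and, Finset.mem_biUnion]
    constructor
    · intro hx
      have h := hne x hx
      refine ⟨σ.cycleOf x, ⟨?_, ?_⟩, ?_⟩
      · rw [Equiv.Perm.cycleOf_mem_cycleFactorsFinset_iff]
        exact Equiv.Perm.mem_support.2 h
      · rw [← minimalPeriod_eq_card_support_cycleOf σ h, hx]
      · exact (Equiv.Perm.mem_support_cycleOf_iff' h).2 (Equiv.Perm.SameCycle.refl _ _)
    · rintro ⟨c, ⟨hc, hci⟩, hxc⟩
      have h := Equiv.Perm.mem_support.1 (Equiv.Perm.mem_cycleFactorsFinset_support_le hc hxc)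
      rw [minimalPeriod_eq_card_support_cycleOf σ h, ← Equiv.Perm.cycle_is_cycleOf hxc hc, hci]
  rw [hset, Finset.card_biUnion, Finset.sum_congr rfl (fun c hc => (Finset.mem_filter.1 hc).2),
    Finset.sum_const, smul_eq_mul, mul_comm]
  · congr 1
    rw [Equiv.Perm.cycleType_def, Multiset.count_map, Finset.card, Finset.filter_val]
    simp only [Function.comp_apply, eq_comm]
  · intro c hc d hd hcd
    have := Equiv.Perm.cycleFactorsFinset_pairwise_disjoint σ (Finset.mem_filter.1 hc).1
      (Finset.mem_filter.1 hd).1 hcd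
    exact this.disjoint_support

/-! ### Cycle types of permutations with a prime-power root -/

/-- If `q` divides a cycle length of the `q ^ l`-th power, the cycle came from a cycle that is
exactly `q ^ l` times as long. -/
theorem div_gcd_prime_pow_eq_iff {q l m i : ℕ} (hq : q.Prime) (hi : q ∣ i) :
    m / m.gcd (q ^ l) = i ↔ m = q ^ l * i := by
  have hr : 0 < q ^ l := pow_pos hq.pos l
  constructor
  · intro h
    obtain ⟨t, ht, hg⟩ := (Nat.dvd_prime_pow hq).1 (Nat.gcd_dvd_right m (q ^ l))
    rw [hg] at h
    have hm : m = q ^ t * i := by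
      rw [← h, Nat.mul_div_cancel' (hg ▸ Nat.gcd_dvd_left m _)]
    rcases ht.eq_or_lt with rfl | hlt
    · exact hm
    · exfalso
      -- As `q ∣ i`, the gcd would contain one more factor `q`.
      have h1 : q ^ (t + 1) ∣ m := by
        rw [hm, pow_succ]; exact mul_dvd_mul_left _ hi
      have h2 := Nat.dvd_gcd h1 (pow_dvd_pow q (show t + 1 ≤ l from hlt))
      rw [hg] at h2
      exact absurd ((Nat.pow_dvd_pow_iff_le_right hq.one_lt).1 h2) (by omega)
  · rintro rfl
    rw [Nat.gcd_eq_right (dvd_mul_right _ _), Nat.mul_div_cancel_left _ hr]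

open Function in
theorem minimalPeriod_pow_perm {α : Type*} (π : Equiv.Perm α) {r : ℕ} (hr : r ≠ 0) (x : α) :
    minimalPeriod (π ^ r : Equiv.Perm α) x = minimalPeriod π x / (minimalPeriod π x).gcd r := by
  rw [Equiv.Perm.coe_pow, minimalPeriod_iterate_eq_div_gcd hr]

open Function in
theorem count_cycleType_pow {α : Type*} [Fintype α] [DecidableEq α] (π : Equiv.Perm α)
    {q l i : ℕ} (hq : q.Prime) (hi : q ∣ i) (hi0 : 0 < i) :
    (π ^ q ^ l).cycleType.count i = q ^ l * π.cycleType.count (q ^ l * i) := by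
  have h2 : 2 ≤ i := hq.two_le.trans (Nat.le_of_dvd hi0 hi)
  have hr : 0 < q ^ l := pow_pos hq.pos l
  have h2' : 2 ≤ q ^ l * i := h2.trans (Nat.le_mul_of_pos_left _ hr)
  have h := card_filter_minimalPeriod_eq (π ^ q ^ l) h2
  have h' := card_filter_minimalPeriod_eq π h2'
  simp_rw [minimalPeriod_pow_perm π hr.ne', div_gcd_prime_pow_eq_iff hq hi] at h
  rw [h] at h'
  apply Nat.eq_of_mul_eq_mul_left hi0
  rw [h']; ring

/-- The cycle type of a `q ^ l`-th root of a permutation with cycle type `m`. -/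
def rootCycleType (q r : ℕ) (m : Multiset ℕ) : Multiset ℕ :=
  m.filter (fun i => ¬ q ∣ i) +
    ∑ i ∈ m.toFinset.filter (fun i => q ∣ i), Multiset.replicate (m.count i / r) (r * i)

theorem mem_rootCycleType {q r i : ℕ} {m : Multiset ℕ} (h : i ∈ rootCycleType q r m) :
    (i ∈ m ∧ ¬ q ∣ i) ∨ ∃ j ∈ m, q ∣ j ∧ i = r * j := by
  rw [rootCycleType, Multiset.mem_add] at h
  rcases h with h | h
  · exact Or.inl (Multiset.mem_filter.1 h)
  · rw [Multiset.mem_sum] at h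
    obtain ⟨j, hj, hij⟩ := h
    rw [Finset.mem_filter, Multiset.mem_toFinset] at hj
    exact Or.inr ⟨j, hj.1, hj.2, Multiset.eq_of_mem_replicate hij⟩

/-- Merging `r` cycles of length `i` into one of length `r * i` keeps the number of points, and
divisibility of the counts leaves no remainder. -/
theorem sum_rootCycleType {q r : ℕ} {m : Multiset ℕ}
    (hm : ∀ i, q ∣ i → r ∣ m.count i) : (rootCycleType q r m).sum = m.sum := by
  conv_rhs => rw [← Multiset.filter_add_not (fun i => q ∣ i) m]
  rw [rootCycleType, Multiset.sum_add, Multiset.sum_add, add_comm, Multiset.sum_sum]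
  congr 1
  rw [Finset.sum_multiset_count, Multiset.toFinset_filter]
  apply Finset.sum_congr rfl
  intro i hi
  have hqi := (Finset.mem_filter.1 hi).2
  rw [Multiset.sum_replicate, Multiset.count_filter_of_pos hqi, smul_eq_mul, smul_eq_mul,
    ← mul_assoc, Nat.div_mul_cancel (hm i hqi)]

theorem count_rootCycleType_of_dvd {q r i : ℕ} {m : Multiset ℕ} (hr : 0 < r) (hqr : q ∣ r)
    (hi : q ∣ i) : (rootCycleType q r m).count (r * i) = m.count i / r := by
  rw [rootCycleType, Multiset.count_add, Multiset.count_filter_of_neg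
    (by simpa using hqr.mul_right i), zero_add, Multiset.count_sum']
  simp only [Multiset.count_replicate, Nat.mul_right_inj hr.ne']
  rw [Finset.sum_ite_eq']
  split_ifs with h
  · rfl
  · rw [Finset.mem_filter, Multiset.mem_toFinset] at h
    rw [Multiset.count_eq_zero_of_notMem (fun h' => h ⟨h', hi⟩), Nat.zero_div]

theorem count_rootCycleType_of_not_dvd {q r i : ℕ} {m : Multiset ℕ} (hqr : q ∣ r)
    (hi : ¬ q ∣ i) : (rootCycleType q r m).count i = m.count i := by
  rw [rootCycleType, Multiset.count_add, Multiset.count_filter_of_pos (p := fun i => ¬ q ∣ i) hi,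
    Multiset.count_sum',
    Finset.sum_eq_zero, add_zero]
  intro j _
  rw [Multiset.count_replicate, if_neg]
  rintro rfl
  exact hi (hqr.mul_right j)

open Function in
/-- A permutation has a `q ^ l`-th root iff the number of its cycles of each length divisible
by `q` is a multiple of `q ^ l`. -/
theorem hasPermRoot_prime_pow_iff {α : Type*} [Fintype α] [DecidableEq α] {q l : ℕ}
    (hq : q.Prime) (hl : 1 ≤ l) (σ : Equiv.Perm α) :
    HasPermRoot (q ^ l) σ ↔ ∀ i, q ∣ i → q ^ l ∣ σ.cycleType.count i := by
  have hr : 0 < q ^ l := pow_pos hq.pos l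
  have hqr : q ∣ q ^ l := dvd_pow_self q (by omega)
  constructor
  · rintro ⟨π, rfl⟩ i hi
    rcases Nat.eq_zero_or_pos i with rfl | hi0
    · rw [Multiset.count_eq_zero_of_notMem]
      · exact dvd_zero _
      · intro h; exact absurd (Equiv.Perm.two_le_of_mem_cycleType h) (by omega)
    · rw [count_cycleType_pow π hq hi hi0]
      exact dvd_mul_right _ _
  · intro h
    have hex : ∃ π : Equiv.Perm α, π.cycleType = rootCycleType q (q ^ l) σ.cycleType := by
      rw [Equiv.Perm.exists_with_cycleType_iff, sum_rootCycleType h, Equiv.Perm.sum_cycleType]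
      refine ⟨Finset.card_le_univ _, fun a ha => ?_⟩
      rcases mem_rootCycleType ha with ⟨ha, _⟩ | ⟨j, hj, _, rfl⟩
      · exact Equiv.Perm.two_le_of_mem_cycleType ha
      · exact (Equiv.Perm.two_le_of_mem_cycleType hj).trans (Nat.le_mul_of_pos_left _ hr)
    obtain ⟨π, hπ⟩ := hex
    have hct : (π ^ q ^ l).cycleType = σ.cycleType := by
      ext i
      by_cases hi2 : 2 ≤ i
      swap
      · rw [Multiset.count_eq_zero_of_notMem, Multiset.count_eq_zero_of_notMem] <;>
        · intro h; exact hi2 (Equiv.Perm.two_le_of_mem_cycleType h)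
      by_cases hi : q ∣ i
      · rw [count_cycleType_pow π hq hi (by omega), hπ, count_rootCycleType_of_dvd hr hqr hi,
          Nat.mul_div_cancel' (h i hi)]
      · rw [← count_rootCycleType_of_not_dvd (m := σ.cycleType) hqr hi, ← hπ]
        apply Nat.eq_of_mul_eq_mul_left (show 0 < i by omega)
        rw [← card_filter_minimalPeriod_eq _ hi2, ← card_filter_minimalPeriod_eq _ hi2]
        congr 1
        ext x
        simp only [Finset.mem_filter, Finset.mem_univ, true_and]
        rw [minimalPeriod_pow_perm π hr.ne']
        constructor
        · intro hx
          -- A period of `π` divisible by `q` can only be some `r * j` with `q ∣ j`, which yields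
          -- period `j` for the power; but `q ∤ i`.
          by_cases hqm : q ∣ minimalPeriod π x
          · exfalso
            have hmem : minimalPeriod π x ∈ π.cycleType := by
              rw [← Multiset.count_pos]
              have hpos : 0 < minimalPeriod π x :=
                Nat.pos_of_ne_zero fun h0 => by rw [h0, Nat.zero_div] at hx; omega
              have h2 := hq.two_le.trans (Nat.le_of_dvd hpos hqm)
              have := card_filter_minimalPeriod_eq π h2
              apply Nat.pos_of_mul_pos_left (a := minimalPeriod π x)
              rw [← this]
              exact Finset.card_pos.2 ⟨x, by simp⟩
            rw [hπ] at hmem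
            rcases mem_rootCycleType hmem with ⟨_, h'⟩ | ⟨j, hj, hqj, hj'⟩
            · exact h' hqm
            · rw [hj', Nat.gcd_eq_right (dvd_mul_right _ _), Nat.mul_div_cancel_left _ hr] at hx
              exact hi (hx ▸ hqj)
          · rwa [Nat.Coprime.gcd_eq_one
              (Nat.Coprime.pow_right l ((hq.coprime_iff_not_dvd.2 hqm).symm)), Nat.div_one] at hx
        · intro hx
          rw [hx, Nat.Coprime.gcd_eq_one
              (Nat.Coprime.pow_right l ((hq.coprime_iff_not_dvd.2 hi).symm)), Nat.div_one]
    -- The power of `π` is only conjugate to `σ`, so the root is conjugated as well.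
    obtain ⟨g, hg⟩ := isConj_iff.1 (Equiv.Perm.isConj_of_cycleType_eq hct)
    exact ⟨g * π * g⁻¹, by rw [conj_pow, hg]⟩

/-! ### Cauchy's formula in terms of partitions -/

/-- Cycle types omit fixed points while partitions list them as ones; this translates between the
two. -/
theorem Nat.Partition.parts_eq_filter_add_replicate {n : ℕ} (p : n.Partition) :
    p.parts = p.parts.filter (fun i => 2 ≤ i) + Multiset.replicate (p.parts.count 1) 1 := by
  conv_lhs => rw [← Multiset.filter_add_not (fun i => 2 ≤ i) p.parts]
  rw [← Multiset.filter_eq']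
  congr 1
  apply Multiset.filter_congr
  intro i hi
  have := p.parts_pos hi
  omega

theorem Nat.Partition.count_one_add_sum_filter {n : ℕ} (p : n.Partition) :
    (p.parts.filter (fun i => 2 ≤ i)).sum + p.parts.count 1 = n := by
  conv_rhs => rw [← p.parts_sum, p.parts_eq_filter_add_replicate]
  simp

theorem Nat.Partition.prod_pow_mul_factorial {n : ℕ} (p : n.Partition) :
    ∏ i ∈ p.parts.toFinset, i ^ p.parts.count i * (p.parts.count i).factorial =
      (n - (p.parts.filter (fun i => 2 ≤ i)).sum).factorial *
        (p.parts.filter (fun i => 2 ≤ i)).prod *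
        ∏ i ∈ (p.parts.filter (fun i => 2 ≤ i)).toFinset,
          ((p.parts.filter (fun i => 2 ≤ i)).count i).factorial := by
  have h1 : n - (p.parts.filter (fun i => 2 ≤ i)).sum = p.parts.count 1 := by
    have := p.count_one_add_sum_filter
    omega
  have h2 : p.parts.prod = (p.parts.filter (fun i => 2 ≤ i)).prod := by
    conv_lhs => rw [p.parts_eq_filter_add_replicate]
    simp
  have h3 : ∏ i ∈ (p.parts.filter (fun i => 2 ≤ i)).toFinset,
      ((p.parts.filter (fun i => 2 ≤ i)).count i).factorial =
      ∏ i ∈ (p.parts.filter (fun i => 2 ≤ i)).toFinset, (p.parts.count i).factorial := by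
    apply Finset.prod_congr rfl
    intro i hi
    rw [Multiset.count_filter_of_pos (Multiset.mem_filter.1 (Multiset.mem_toFinset.1 hi)).2]
  have h4 : ∏ i ∈ p.parts.toFinset, (p.parts.count i).factorial =
      ∏ i ∈ insert 1 (p.parts.filter (fun i => 2 ≤ i)).toFinset,
        (p.parts.count i).factorial := by
    apply Finset.prod_subset
    · intro i hi
      rw [Multiset.mem_toFinset] at hi
      rw [Finset.mem_insert, Multiset.mem_toFinset, Multiset.mem_filter]
      have := p.parts_pos hi
      by_cases h : i = 1
      · exact Or.inl h
      · exact Or.inr ⟨hi, by omega⟩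
    · intro i _ hi
      rw [Multiset.mem_toFinset] at hi
      rw [Multiset.count_eq_zero_of_notMem hi, Nat.factorial_zero]
  rw [Finset.prod_mul_distrib, ← Finset.prod_multiset_count, h1, h2, h3, h4,
    Finset.prod_insert (by simp)]
  ring

theorem Equiv.Perm.partition_eq_iff {α : Type*} [Fintype α] [DecidableEq α] (σ : Equiv.Perm α)
    (p : (Fintype.card α).Partition) :
    σ.partition = p ↔ σ.cycleType = p.parts.filter (fun i => 2 ≤ i) := by
  constructor
  · rintro rfl
    exact Equiv.Perm.filter_parts_partition_eq_cycleType.symm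
  · intro h
    ext1
    have h1 := p.count_one_add_sum_filter
    rw [Equiv.Perm.parts_partition, h, ← Equiv.Perm.sum_cycleType, h]
    conv_rhs => rw [p.parts_eq_filter_add_replicate]
    congr 2
    omega

/-- The number of permutations with a given partition, in terms of Cauchy's formula. -/
theorem Equiv.Perm.card_filter_partition_eq_mul {α : Type*} [Fintype α] [DecidableEq α]
    (p : (Fintype.card α).Partition) :
    (Finset.univ.filter fun σ : Equiv.Perm α => σ.partition = p).card *
      ∏ i ∈ p.parts.toFinset, i ^ p.parts.count i * (p.parts.count i).factorial =
      (Fintype.card α).factorial := by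
  simp_rw [Equiv.Perm.partition_eq_iff]
  rw [p.prod_pow_mul_factorial, Equiv.Perm.card_of_cycleType_mul_eq, if_pos]
  refine ⟨?_, fun a ha => (Multiset.mem_filter.1 ha).2⟩
  have := p.count_one_add_sum_filter
  omega

/-! ### Generating functions for cycle-count conditions -/

/-- The weight of `k` cycles of length `i`, when only the pairs `(i, k)` satisfying `P` are
allowed. -/
noncomputable def cycleWeight (P : ℕ → ℕ → Prop) (i k : ℕ) : ℝ :=
  open Classical in if P i k then 1 / ((i : ℝ) ^ k * k.factorial) else 0

theorem cycleWeight_of_pos {P : ℕ → ℕ → Prop} {i k : ℕ} (h : P i k) :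
    cycleWeight P i k = 1 / ((i : ℝ) ^ k * k.factorial) := if_pos h

theorem cycleWeight_of_neg {P : ℕ → ℕ → Prop} {i k : ℕ} (h : ¬ P i k) :
    cycleWeight P i k = 0 := if_neg h

theorem cycleWeight_nonneg (P : ℕ → ℕ → Prop) (i k : ℕ) : 0 ≤ cycleWeight P i k := by
  unfold cycleWeight
  split_ifs <;> positivity

theorem prod_cycleWeight (P : ℕ → ℕ → Prop) [DecidablePred fun m : Multiset ℕ =>
    ∀ i ∈ m, P i (m.count i)] (m : Multiset ℕ) :
    m.toFinsupp.prod (cycleWeight P) = if ∀ i ∈ m, P i (m.count i) then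
      1 / ((∏ i ∈ m.toFinset, i ^ m.count i * (m.count i).factorial : ℕ) : ℝ) else 0 := by
  rw [Finsupp.prod, Multiset.toFinsupp_support]
  simp only [Multiset.toFinsupp_apply]
  split_ifs with h
  · push_cast
    rw [one_div, ← Finset.prod_inv_distrib]
    apply Finset.prod_congr rfl
    intro i hi
    rw [cycleWeight_of_pos (h i (Multiset.mem_toFinset.1 hi)), one_div]
  · push Not at h
    obtain ⟨i, hi, hP⟩ := h
    exact Finset.prod_eq_zero (Multiset.mem_toFinset.2 hi) (cycleWeight_of_neg hP)

open Classical in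
/-- The proportion of permutations whose cycle counts satisfy `P`, as a coefficient of a
generating function. -/
theorem card_filter_partition_div_factorial {α : Type*} [Fintype α] [DecidableEq α]
    (P : ℕ → ℕ → Prop) :
    ((Finset.univ.filter fun σ : Equiv.Perm α => ∀ i ∈ σ.partition.parts,
      P i (σ.partition.parts.count i)).card : ℝ) / (Fintype.card α).factorial =
    (Nat.Partition.genFun (cycleWeight P)).coeff (Fintype.card α) := by
  rw [Nat.Partition.coeff_genFun, Finset.card_eq_sum_card_fiberwise
    (f := fun σ : Equiv.Perm α => σ.partition) (t := Finset.univ) (fun _ _ => Finset.mem_univ _),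
    Nat.cast_sum, Finset.sum_div]
  apply Finset.sum_congr rfl
  intro p _
  rw [prod_cycleWeight]
  have h := Equiv.Perm.card_filter_partition_eq_mul (α := α) p
  have hpos : ((∏ i ∈ p.parts.toFinset, i ^ p.parts.count i * (p.parts.count i).factorial : ℕ) : ℝ)
      ≠ 0 := by
    intro h0
    rw [Nat.cast_eq_zero] at h0
    rw [h0, mul_zero] at h
    exact (Nat.factorial_pos _).ne h
  split_ifs with hP
  · rw [div_eq_div_iff (by positivity) hpos, one_mul, ← Nat.cast_mul, ← h]
    congr 3
    ext σ
    simp only [Finset.mem_filter, Finset.mem_univ, true_and]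
    constructor
    · exact fun h => h.2
    · rintro rfl; exact ⟨hP, rfl⟩
  · rw [Finset.card_eq_zero.2, Nat.cast_zero, zero_div]
    rw [Finset.filter_eq_empty_iff]
    intro σ hσ hp
    subst hp
    exact hP (Finset.mem_filter.1 hσ).2

theorem rootProb_eq_coeff_genFun {q l : ℕ} (hq : q.Prime) (hl : 1 ≤ l) (n : ℕ) :
    rootProb (q ^ l) n =
      (Nat.Partition.genFun (cycleWeight fun i k => q ∣ i → q ^ l ∣ k)).coeff n := by
  classical
  have h := card_filter_partition_div_factorial (α := Fin n) (fun i k => q ∣ i → q ^ l ∣ k)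
  have hn : ∀ G : PowerSeries ℝ, G.coeff (Fintype.card (Fin n)) = G.coeff n := by
    simp
  rw [← hn, ← h, rootProb, Nat.card_eq_fintype_card (α := Equiv.Perm (Fin n)), Fintype.card_perm,
    Nat.card_eq_fintype_card, Fintype.card_subtype]
  congr 3
  ext σ
  simp only [Finset.mem_filter, Finset.mem_univ, true_and]
  rw [hasPermRoot_prime_pow_iff hq hl]
  -- Fixed points do not matter, since `q ∤ 1`.
  have hc : ∀ i, q ∣ i → σ.partition.parts.count i = σ.cycleType.count i := by
    intro i hi
    rw [Equiv.Perm.parts_partition, Multiset.count_add, Multiset.count_replicate, if_neg, add_zero]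
    rintro rfl
    exact hq.one_lt.ne' (Nat.dvd_one.1 hi)
  constructor
  · intro h i _ hi
    rw [hc i hi]; exact h i hi
  · intro h i hi
    by_cases hm : i ∈ σ.partition.parts
    · rw [← hc i hi]; exact h i hm hi
    · rw [← hc i hi, Multiset.count_eq_zero_of_notMem hm]; exact dvd_zero _

open scoped PowerSeries.WithPiTopology in
/-- If every part size is governed by exactly one of two weights, the generating function
factors. -/
theorem Nat.Partition.genFun_eq_mul {f g h : ℕ → ℕ → ℝ}
    (H : ∀ i, (∀ k, f i (k + 1) = g i (k + 1) ∧ h i (k + 1) = 0) ∨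
      (∀ k, f i (k + 1) = h i (k + 1) ∧ g i (k + 1) = 0)) :
    genFun f = genFun g * genFun h := by
  refine (hasProd_genFun f).unique ?_
  convert! (hasProd_genFun g).mul (hasProd_genFun h) using 1
  funext i
  -- In the Euler product one of the two factors at each part size is `1`; multiplicity `0` is built
  -- in as that constant term.
  rcases H (i + 1) with hi | hi
  · simp [fun k => (hi k).1, fun k => (hi k).2]
  · simp [fun k => (hi k).1, fun k => (hi k).2]

/-! ### Recursion obtained by removing equal parts -/

theorem Nat.Partition.sum_filter_le_count {n ρ i : ℕ} (hi : 0 < i) (hn : ρ * i ≤ n)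
    (g : Multiset ℕ → ℝ) :
    ∑ p : n.Partition with ρ ≤ p.parts.count i, g (p.parts - Multiset.replicate ρ i) =
      ∑ p : (n - ρ * i).Partition, g p.parts := by
  have hle : ∀ p : n.Partition, ρ ≤ p.parts.count i → Multiset.replicate ρ i ≤ p.parts :=
    fun p hp => Multiset.le_count_iff_replicate_le.1 hp
  refine Finset.sum_bij' (fun p hp => ⟨p.parts - Multiset.replicate ρ i, ?_, ?_⟩)
    (fun p _ => ⟨p.parts + Multiset.replicate ρ i, ?_, ?_⟩) ?_ ?_ ?_ ?_ ?_
  · intro j hj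
    exact p.parts_pos (Multiset.mem_of_le (Multiset.sub_le_self _ _) hj)
  · have h := congrArg Multiset.sum
      (tsub_add_cancel_of_le (hle p (Finset.mem_filter.1 hp).2))
    rw [Multiset.sum_add, Multiset.sum_replicate, smul_eq_mul, p.parts_sum] at h
    omega
  · intro j hj
    rcases Multiset.mem_add.1 hj with hj | hj
    · exact p.parts_pos hj
    · exact (Multiset.eq_of_mem_replicate hj) ▸ hi
  · rw [Multiset.sum_add, Multiset.sum_replicate, smul_eq_mul, p.parts_sum]
    omega
  · intros; exact Finset.mem_univ _
  · intro p _
    simp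
  · intro p hp
    ext1
    exact tsub_add_cancel_of_le (hle p (Finset.mem_filter.1 hp).2)
  · intro p _
    ext1
    exact add_tsub_cancel_right _ _
  · intros; rfl

theorem Multiset.toFinsupp_prod_eq_mul_erase {f : ℕ → ℕ → ℝ} (hf : ∀ i, f i 0 = 1)
    (m : Multiset ℕ) {s : Finset ℕ} (hs : m.toFinset ⊆ s) {i : ℕ} (hi : i ∈ s) :
    m.toFinsupp.prod f = f i (m.count i) * ∏ j ∈ s.erase i, f j (m.count j) := by
  rw [Finsupp.prod_of_support_subset _ (s := s) (by simpa using hs) _ (fun j _ => hf j)]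
  simp only [Multiset.toFinsupp_apply]
  exact (Finset.mul_prod_erase s _ hi).symm

theorem Multiset.toFinsupp_prod_mul_eq_sub_replicate {f : ℕ → ℕ → ℝ} (hf : ∀ i, f i 0 = 1)
    {m : Multiset ℕ} {ρ i : ℕ} {a b : ℝ}
    (hab : f i (m.count i) * a = b * f i (m.count i - ρ)) :
    m.toFinsupp.prod f * a = b * (m - Multiset.replicate ρ i).toFinsupp.prod f := by
  have hs : (m - Multiset.replicate ρ i).toFinset ⊆ insert i m.toFinset :=
    (Multiset.toFinset_subset.2 (Multiset.subset_of_le (Multiset.sub_le_self _ _))).trans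
      (Finset.subset_insert _ _)
  rw [Multiset.toFinsupp_prod_eq_mul_erase hf m (Finset.subset_insert i _)
      (Finset.mem_insert_self i _),
    Multiset.toFinsupp_prod_eq_mul_erase hf _ hs (Finset.mem_insert_self i _)]
  have hR : ∏ j ∈ (insert i m.toFinset).erase i,
      f j ((m - Multiset.replicate ρ i).count j) =
      ∏ j ∈ (insert i m.toFinset).erase i, f j (m.count j) := by
    apply Finset.prod_congr rfl
    intro j hj
    rw [Multiset.count_sub, Multiset.count_replicate, if_neg (Finset.ne_of_mem_erase hj).symm,
      Nat.sub_zero]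
  rw [hR, Multiset.count_sub, Multiset.count_replicate_self, mul_right_comm, hab]
  ring

/-- Removing `ρ` copies of a part yields a recursion for the coefficients of a generating
function of partitions. -/
theorem Nat.Partition.mul_coeff_genFun {f c : ℕ → ℕ → ℝ} {ρ : ℕ}
    (hf : ∀ i, f i 0 = 1) (hlow : ∀ i k, 0 < i → 0 < k → k < ρ → f i k = 0)
    (hc : ∀ i k, 0 < i → f i (k + ρ) * (i * (k + ρ : ℕ)) = c i k * f i k) (n : ℕ) :
    n * (genFun f).coeff n = ∑ i ∈ Finset.Icc 1 n with ρ * i ≤ n,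
      ∑ p : (n - ρ * i).Partition, c i (p.parts.count i) * p.parts.toFinsupp.prod f := by
  have hsum : ∀ p : n.Partition, (n : ℝ) = ∑ i ∈ Finset.Icc 1 n, (i : ℝ) * p.parts.count i := by
    intro p
    have h := (Finset.mem_finsuppAntidiag.1 p.toFinsuppAntidiag_mem_finsuppAntidiag).1
    conv_lhs => rw [← h]
    push_cast
    apply Finset.sum_congr rfl
    intro i _
    simp [toFinsuppAntidiag, mul_comm]
  have hterm : ∀ i ∈ Finset.Icc 1 n,
      ∑ p : n.Partition, p.parts.toFinsupp.prod f * ((i : ℝ) * p.parts.count i) =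
      if ρ * i ≤ n then
        ∑ p : (n - ρ * i).Partition, c i (p.parts.count i) * p.parts.toFinsupp.prod f
      else 0 := by
    intro i hi
    have hi0 : 0 < i := (Finset.mem_Icc.1 hi).1
    -- Multiplicity `0` is killed by the factor `p.parts.count i`, multiplicities strictly between
    -- `0` and `ρ` by `hlow`.
    have hfil : ∑ p : n.Partition, p.parts.toFinsupp.prod f * ((i : ℝ) * p.parts.count i) =
        ∑ p : n.Partition with ρ ≤ p.parts.count i,
          p.parts.toFinsupp.prod f * ((i : ℝ) * p.parts.count i) := by
      symm
      apply Finset.sum_subset (Finset.filter_subset _ _)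
      intro p _ hp
      have hlt : p.parts.count i < ρ := by simpa using hp
      rcases Nat.eq_zero_or_pos (p.parts.count i) with h0 | h0
      · simp [h0]
      · have := hlow i _ hi0 h0 hlt
        rw [Multiset.toFinsupp_prod_eq_mul_erase hf p.parts (Finset.subset_insert i _)
          (Finset.mem_insert_self i _), this, zero_mul, zero_mul]
    rw [hfil]
    split_ifs with hn
    · rw [← sum_filter_le_count hi0 hn (fun m => c i (m.count i) * m.toFinsupp.prod f)]
      apply Finset.sum_congr rfl
      intro p hp
      have hp := (Finset.mem_filter.1 hp).2
      have h := hc i (p.parts.count i - ρ) hi0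
      rw [Nat.sub_add_cancel hp] at h
      rw [Multiset.toFinsupp_prod_mul_eq_sub_replicate hf h, Multiset.count_sub,
        Multiset.count_replicate_self]
    · rw [Finset.sum_eq_zero]
      intro p hp
      exfalso
      have h2 := Multiset.le_count_iff_replicate_le.1 (Finset.mem_filter.1 hp).2
      have h3 := congrArg Multiset.sum (tsub_add_cancel_of_le h2)
      rw [Multiset.sum_add, Multiset.sum_replicate, smul_eq_mul, p.parts_sum] at h3
      omega
  rw [Finset.sum_filter, ← Finset.sum_congr rfl hterm, Finset.sum_comm, coeff_genFun,
    Finset.mul_sum]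
  apply Finset.sum_congr rfl
  intro p _
  rw [← Finset.mul_sum, ← hsum p, mul_comm]

/-! ### The binomial coefficients and their recursion -/

/-- The coefficients of `(1 - y) ^ (-(1 - 1 / q))`. -/
noncomputable def binomCoeff (q : ℕ) : ℕ → ℝ
  | 0 => 1
  | k + 1 => binomCoeff q k * ((q * (k + 1 : ℕ) - 1) / (q * (k + 1 : ℕ)))

theorem binomCoeff_succ (q k : ℕ) :
    binomCoeff q (k + 1) = binomCoeff q k * ((q * (k + 1 : ℕ) - 1) / (q * (k + 1 : ℕ))) := rfl

theorem mul_binomCoeff_succ {q : ℕ} (hq : 0 < q) (k : ℕ) :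
    (q * (k + 1 : ℕ) : ℝ) * binomCoeff q (k + 1) = (q * (k + 1 : ℕ) - 1) * binomCoeff q k := by
  have : (q : ℝ) ≠ 0 := by positivity
  have : ((k + 1 : ℕ) : ℝ) ≠ 0 := by positivity
  rw [binomCoeff_succ]
  field_simp

theorem binomCoeff_pos {q : ℕ} (hq : 2 ≤ q) (k : ℕ) : 0 < binomCoeff q k := by
  induction k with
  | zero => exact one_pos
  | succ k ih =>
    rw [binomCoeff_succ]
    have h : (2 : ℝ) ≤ q := by exact_mod_cast hq
    have h1 : (1 : ℝ) ≤ (k + 1 : ℕ) := by exact_mod_cast Nat.succ_pos k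
    have : (0 : ℝ) < q * (k + 1 : ℕ) - 1 := by nlinarith
    positivity

/-- Each full block of `q` indices omits one residue and adds `(q - 1) * u k`, which telescopes by
`mul_binomCoeff_succ`. The final partial block stops just before the omitted residue `e`. -/
theorem sum_range_binomCoeff_div {q e : ℕ} (he : e < q) (m : ℕ) :
    ∑ t ∈ Finset.range (q * m + e), (if t % q = e then 0 else binomCoeff q (t / q)) =
      ((q * m + e : ℕ) : ℝ) * binomCoeff q m := by
  have hq : 0 < q := by omega
  have hfull : ∑ t ∈ Finset.range (q * m), (if t % q = e then 0 else binomCoeff q (t / q)) =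
      (q * m : ℝ) * binomCoeff q m := by
    induction m with
    | zero => simp
    | succ m ih =>
      rw [Nat.mul_succ, Finset.sum_range_add, ih]
      have hblock : ∑ x ∈ Finset.range q,
          (if (q * m + x) % q = e then 0 else binomCoeff q ((q * m + x) / q)) =
          ∑ x ∈ Finset.range q, (binomCoeff q m - if x = e then binomCoeff q m else 0) := by
        apply Finset.sum_congr rfl
        intro x hx
        have hx := Finset.mem_range.1 hx
        rw [Nat.mul_add_mod, Nat.mod_eq_of_lt hx, Nat.mul_add_div hq, Nat.div_eq_of_lt hx,
          add_zero]
        split_ifs <;> simp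
      rw [hblock, Finset.sum_sub_distrib, Finset.sum_const, Finset.card_range,
        Finset.sum_ite_eq', if_pos (Finset.mem_range.2 he), mul_binomCoeff_succ hq, nsmul_eq_mul]
      push_cast
      ring
  have htail : ∑ x ∈ Finset.range e,
      (if (q * m + x) % q = e then 0 else binomCoeff q ((q * m + x) / q)) =
      ∑ x ∈ Finset.range e, binomCoeff q m := by
    apply Finset.sum_congr rfl
    intro x hx
    have hx := Finset.mem_range.1 hx
    have hxq : x < q := hx.trans he
    rw [Nat.mul_add_mod, Nat.mod_eq_of_lt hxq, Nat.mul_add_div hq, Nat.div_eq_of_lt hxq,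
      add_zero, if_neg hx.ne]
  rw [Finset.sum_range_add, hfull, htail, Finset.sum_const, Finset.card_range, nsmul_eq_mul]
  push_cast
  ring

/-- Substitute `t = n - i`: then `q ∣ i` means `t ≡ n` modulo `q`. This is the recursion in
`mul_avoidProb`, which determines `avoidProb`. -/
theorem sum_filter_not_dvd_binomCoeff {q : ℕ} (hq : 0 < q) (n : ℕ) :
    ∑ i ∈ Finset.Icc 1 n, (if q ∣ i then 0 else binomCoeff q ((n - i) / q)) =
      n * binomCoeff q (n / q) := by
  have h := sum_range_binomCoeff_div (Nat.mod_lt n hq) (n / q)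
  rw [Nat.div_add_mod] at h
  rw [← h]
  refine Finset.sum_bij' (fun i _ => n - i) (fun t _ => n - t) ?_ ?_ ?_ ?_ ?_
  · intro i hi
    rw [Finset.mem_Icc] at hi
    rw [Finset.mem_range]; omega
  · intro t ht
    rw [Finset.mem_range] at ht
    rw [Finset.mem_Icc]; omega
  · intro i hi
    rw [Finset.mem_Icc] at hi
    omega
  · intro t ht
    rw [Finset.mem_range] at ht
    omega
  · intro i hi
    rw [Finset.mem_Icc] at hi
    have hiff : q ∣ i ↔ (n - i) % q = n % q := by
      have h := Nat.modEq_iff_dvd' (n := q) (Nat.sub_le n i)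
      rw [Nat.sub_sub_self hi.2] at h
      exact h.symm
    simp only [hiff]

theorem cycleWeight_zero {P : ℕ → ℕ → Prop} {i : ℕ} (h : P i 0) : cycleWeight P i 0 = 1 := by
  simp [cycleWeight_of_pos h]

/-! ### The two factors and the convolution formula -/

/-- The proportion of permutations having no cycle of length divisible by `q`. -/
noncomputable def avoidProb (q n : ℕ) : ℝ :=
  (Nat.Partition.genFun (cycleWeight fun i k => k = 0 ∨ ¬ q ∣ i)).coeff n

/-- The proportion of permutations all of whose cycle lengths are divisible by `q`, each length
occurring a multiple of `r` times. -/
noncomputable def fullProb (q r n : ℕ) : ℝ :=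
  (Nat.Partition.genFun (cycleWeight fun i k => k = 0 ∨ (q ∣ i ∧ r ∣ k))).coeff n

theorem coeff_zero_genFun (f : ℕ → ℕ → ℝ) : (Nat.Partition.genFun f).coeff 0 = 1 := by
  rw [Nat.Partition.coeff_genFun, Fintype.sum_unique]
  simp

theorem mul_avoidProb (q n : ℕ) :
    n * avoidProb q n = ∑ i ∈ Finset.Icc 1 n, if q ∣ i then 0 else avoidProb q (n - i) := by
  have h := Nat.Partition.mul_coeff_genFun (f := cycleWeight fun i k => k = 0 ∨ ¬ q ∣ i)
    (c := fun i _ => if q ∣ i then 0 else 1) (ρ := 1) (fun i => cycleWeight_zero (Or.inl rfl))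
    (by intros; omega) ?_ n
  · rw [avoidProb, h]
    rw [Finset.filter_true_of_mem (fun i hi => by rw [one_mul]; exact (Finset.mem_Icc.1 hi).2)]
    apply Finset.sum_congr rfl
    intro i _
    rw [one_mul]
    split_ifs
    · simp
    · simp [avoidProb]
  · intro i k hi
    have : (i : ℝ) ≠ 0 := by positivity
    split_ifs with hqi
    · rw [cycleWeight_of_neg (by simp [hqi]), zero_mul, zero_mul]
    · rw [cycleWeight_of_pos (Or.inr hqi), cycleWeight_of_pos (Or.inr hqi), Nat.factorial_succ]
      have : ((k + 1 : ℕ) : ℝ) ≠ 0 := by positivity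
      have : (k.factorial : ℝ) ≠ 0 := by positivity
      push_cast at *
      field_simp
      ring

theorem avoidProb_eq_binomCoeff {q : ℕ} (hq : 0 < q) (n : ℕ) :
    avoidProb q n = binomCoeff q (n / q) := by
  induction n using Nat.strong_induction_on with
  | _ n ih =>
    rcases Nat.eq_zero_or_pos n with rfl | hn
    · rw [Nat.zero_div]; exact coeff_zero_genFun _
    · have hn' : (n : ℝ) ≠ 0 := by positivity
      apply mul_left_cancel₀ hn'
      rw [mul_avoidProb, ← sum_filter_not_dvd_binomCoeff hq]
      apply Finset.sum_congr rfl
      intro i hi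
      have := (Finset.mem_Icc.1 hi).1
      rw [ih (n - i) (by omega)]

theorem fullProb_eq_zero {q r n : ℕ} (h : ¬ q * r ∣ n) : fullProb q r n = 0 := by
  classical
  rw [fullProb, Nat.Partition.coeff_genFun]
  apply Finset.sum_eq_zero
  intro p _
  rw [prod_cycleWeight, if_neg]
  intro hp
  apply h
  rw [← p.parts_sum, Finset.sum_multiset_count]
  apply Finset.dvd_sum
  intro i hi
  rw [Multiset.mem_toFinset] at hi
  rcases hp i hi with h0 | ⟨h1, h2⟩
  · exact absurd hi (Multiset.count_eq_zero.1 h0)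
  · rw [smul_eq_mul, mul_comm q r]
    exact mul_dvd_mul h2 h1

theorem toFinsupp_prod_cycleWeight_nonneg (P : ℕ → ℕ → Prop) (m : Multiset ℕ) :
    0 ≤ m.toFinsupp.prod (cycleWeight P) :=
  Finset.prod_nonneg fun _ _ => cycleWeight_nonneg _ _ _

/-- This is the contribution of the single partition into `r * s` parts equal to `q`. -/
theorem one_div_le_fullProb_mul {q r : ℕ} (hq : 0 < q) (s : ℕ) :
    1 / ((q : ℝ) ^ (r * s) * (r * s).factorial) ≤ fullProb q r (q * r * s) := by
  classical
  rw [fullProb, Nat.Partition.coeff_genFun]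
  let p : (q * r * s).Partition := ⟨Multiset.replicate (r * s) q,
    fun hi => by rwa [Multiset.eq_of_mem_replicate hi],
    by rw [Multiset.sum_replicate, smul_eq_mul]; ring⟩
  refine le_trans (le_of_eq ?_) (Finset.single_le_sum
    (fun p _ => toFinsupp_prod_cycleWeight_nonneg _ p.parts) (Finset.mem_univ p))
  have hw : cycleWeight (fun i k => k = 0 ∨ (q ∣ i ∧ r ∣ k)) q (r * s) =
      1 / ((q : ℝ) ^ (r * s) * (r * s).factorial) :=
    cycleWeight_of_pos (Or.inr ⟨dvd_rfl, dvd_mul_right _ _⟩)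
  rw [Finsupp.prod_of_support_subset _ (s := {q})
    (fun j hj => Finset.mem_singleton.2 (Multiset.eq_of_mem_replicate (n := r * s)
      (by simpa only [Multiset.toFinsupp_support, Multiset.mem_toFinset] using hj))) _
    (fun j _ => cycleWeight_zero (Or.inl rfl)), Finset.prod_singleton, ← hw]
  simp [p]

theorem fullProb_mul_pos {q r : ℕ} (hq : 0 < q) (s : ℕ) : 0 < fullProb q r (q * r * s) :=
  lt_of_lt_of_le (by positivity) (one_div_le_fullProb_mul hq s)

/-- The exact recursion for `ρ = r` has a coefficient depending on the remaining multiplicity `k`.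
It is largest at `k = 0`, by `k! * (r - 1)! ≤ (k + r - 1)!`, and with that value the inner sum
collapses to `fullProb`. -/
theorem mul_fullProb_le {q r : ℕ} (hr : 0 < r) (n : ℕ) :
    n * fullProb q r n ≤ ∑ i ∈ Finset.Icc 1 n with r * i ≤ n,
      (if q ∣ i then (i : ℝ) / (i ^ r * (r - 1).factorial) else 0) * fullProb q r (n - r * i) := by
  have h := Nat.Partition.mul_coeff_genFun
    (f := cycleWeight fun i k => k = 0 ∨ (q ∣ i ∧ r ∣ k))
    (c := fun i k => if q ∣ i then
      (i * (k + r : ℕ) * k.factorial : ℝ) / (i ^ r * (k + r).factorial) else 0)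
    (ρ := r) (fun i => cycleWeight_zero (Or.inl rfl)) ?_ ?_ n
  · rw [fullProb, h]
    apply Finset.sum_le_sum
    intro i hi
    have hi0 : 0 < i := (Finset.mem_Icc.1 (Finset.mem_filter.1 hi).1).1
    rw [fullProb, Nat.Partition.coeff_genFun, Finset.mul_sum]
    apply Finset.sum_le_sum
    intro p _
    apply mul_le_mul_of_nonneg_right _ (toFinsupp_prod_cycleWeight_nonneg _ _)
    split_ifs
    swap
    · exact le_rfl
    generalize p.parts.count i = k
    obtain ⟨ρ, rfl⟩ : ∃ ρ, r = ρ + 1 := ⟨r - 1, by omega⟩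
    rw [Nat.add_sub_cancel, ← Nat.add_assoc, Nat.factorial_succ]
    have hle : k.factorial * ρ.factorial ≤ (k + ρ).factorial :=
      Nat.le_of_dvd (Nat.factorial_pos _) (Nat.factorial_mul_factorial_dvd_factorial_add k ρ)
    have hle' : (k.factorial * ρ.factorial : ℝ) ≤ (k + ρ).factorial := by exact_mod_cast hle
    rw [div_le_div_iff₀ (by positivity) (by positivity)]
    calc (i * (k + ρ + 1 : ℕ) * k.factorial : ℝ) * (i ^ (ρ + 1) * ρ.factorial)
        = (i * (k + ρ + 1 : ℕ) * i ^ (ρ + 1)) * (k.factorial * ρ.factorial) := by ring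
      _ ≤ (i * (k + ρ + 1 : ℕ) * i ^ (ρ + 1)) * (k + ρ).factorial := by gcongr
      _ = i * (i ^ (ρ + 1) * ((k + ρ + 1) * (k + ρ).factorial : ℕ)) := by push_cast; ring
  · intro i k _ hk hkr
    apply cycleWeight_of_neg
    rintro (h | ⟨_, h⟩)
    · omega
    · exact absurd (Nat.le_of_dvd hk h) (by omega)
  · intro i k hi
    have : (i : ℝ) ≠ 0 := by positivity
    have h1 : (k.factorial : ℝ) ≠ 0 := by positivity
    have h2 : ((k + r).factorial : ℝ) ≠ 0 := by positivity
    by_cases hqi : q ∣ i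
    swap
    · rw [cycleWeight_of_neg (by simp [hqi]; omega), if_neg hqi, zero_mul, zero_mul]
    by_cases hk : r ∣ k
    · rw [cycleWeight_of_pos (Or.inr ⟨hqi, by simpa using hk⟩),
        cycleWeight_of_pos (Or.inr ⟨hqi, hk⟩), if_pos hqi]
      field_simp
      ring
    · rw [cycleWeight_of_neg, cycleWeight_of_neg, zero_mul, mul_zero]
      · rintro (rfl | h)
        · exact hk (dvd_zero _)
        · exact hk h.2
      · rintro (h | h)
        · omega
        · exact hk (by simpa using h.2)

theorem mul_fullProb_mul_le {q r : ℕ} (hq : 0 < q) (hr : 0 < r) (s : ℕ) :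
    (q * r * s : ℝ) * fullProb q r (q * r * s) ≤ ∑ j ∈ Finset.Icc 1 s,
      (q * j : ℝ) / ((q * j) ^ r * (r - 1).factorial) * fullProb q r (q * r * (s - j)) := by
  have h := mul_fullProb_le (q := q) hr (q * r * s)
  push_cast at h
  refine h.trans (le_of_eq ?_)
  symm
  refine Finset.sum_of_injOn (fun j => q * j) ?_ ?_ ?_ ?_
  · intro a _ b _ hab
    exact Nat.eq_of_mul_eq_mul_left hq hab
  · intro j hj
    have hj := Finset.mem_Icc.1 hj
    simp only [Finset.coe_filter, Set.mem_ofPred_eq, Finset.mem_Icc]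
    have h1 : q * r * j ≤ q * r * s := Nat.mul_le_mul_left _ hj.2
    have h2 : q * j ≤ q * r * j := Nat.mul_le_mul_right _ (Nat.le_mul_of_pos_right _ hr)
    refine ⟨⟨Nat.mul_pos hq hj.1, h2.trans h1⟩, ?_⟩
    calc r * (q * j) = q * r * j := by ring
      _ ≤ _ := h1
  · intro i hi hni
    rw [if_neg, zero_mul]
    rintro ⟨j, rfl⟩
    apply hni
    rw [Finset.mem_filter, Finset.mem_Icc] at hi
    refine ⟨j, ?_, rfl⟩
    have h1 : q * r * j ≤ q * r * s := by
      calc q * r * j = r * (q * j) := by ring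
        _ ≤ _ := hi.2
    exact Finset.mem_coe.2 (Finset.mem_Icc.2 ⟨Nat.pos_of_mul_pos_left (a := q) hi.1.1,
      Nat.le_of_mul_le_mul_left h1 (Nat.mul_pos hq hr)⟩)
  · intro j hj
    rw [if_pos (dvd_mul_right _ _)]
    have h1 : q * r * s - r * (q * j) = q * r * (s - j) := by
      rw [Nat.mul_sub]; congr 1; ring
    rw [h1]
    push_cast
    rfl

theorem genFun_rootWeight_eq_mul (q r : ℕ) :
    Nat.Partition.genFun (cycleWeight fun i k => q ∣ i → r ∣ k) =
      Nat.Partition.genFun (cycleWeight fun i k => k = 0 ∨ (q ∣ i ∧ r ∣ k)) *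
        Nat.Partition.genFun (cycleWeight fun i k => k = 0 ∨ ¬ q ∣ i) := by
  apply Nat.Partition.genFun_eq_mul
  intro i
  by_cases h : q ∣ i <;> [left; right] <;> intro k <;> simp [cycleWeight, h]

/-- In the convolution only multiples of `q * r` survive in the first factor, and the second depends
only on the quotient by `q`. -/
theorem rootProb_eq_sum {q l : ℕ} (hq : q.Prime) (hl : 1 ≤ l) (n : ℕ) :
    rootProb (q ^ l) n = ∑ i ∈ Finset.range (n / (q * q ^ l) + 1),
      fullProb q (q ^ l) (q * q ^ l * i) * binomCoeff q (n / q - q ^ l * i) := by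
  have hr : 0 < q ^ l := pow_pos hq.pos l
  have hM : 0 < q * q ^ l := Nat.mul_pos hq.pos hr
  rw [rootProb_eq_coeff_genFun hq hl, genFun_rootWeight_eq_mul, PowerSeries.coeff_mul,
    Finset.Nat.sum_antidiagonal_eq_sum_range_succ_mk]
  symm
  refine Finset.sum_of_injOn (fun i => q * q ^ l * i) ?_ ?_ ?_ ?_
  · intro a _ b _ hab
    exact Nat.eq_of_mul_eq_mul_left hM hab
  · intro i hi
    have hi := Finset.mem_range.1 (Finset.mem_coe.1 hi)
    apply Finset.mem_coe.2 (Finset.mem_range.2 _)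
    have := (Nat.le_div_iff_mul_le hM).1 (Nat.lt_succ_iff.1 hi)
    show q * q ^ l * i < n + 1
    rw [mul_comm]
    omega
  · intro k hk hnk
    have h0 : fullProb q (q ^ l) k = 0 := by
      apply fullProb_eq_zero
      rintro ⟨i, rfl⟩
      apply hnk
      refine ⟨i, Finset.mem_coe.2 (Finset.mem_range.2 (Nat.lt_succ_iff.2 ?_)), rfl⟩
      rw [Nat.le_div_iff_mul_le hM, mul_comm]
      exact Nat.lt_succ_iff.1 (Finset.mem_range.1 hk)
    rw [fullProb] at h0
    rw [h0, zero_mul]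
  · intro i _
    have h := avoidProb_eq_binomCoeff hq.pos (n - q * q ^ l * i)
    rw [mul_assoc, Nat.sub_mul_div] at h
    rw [← h, avoidProb, fullProb, mul_assoc]

/-! ### Estimates behind case (ii) -/

/-- A crude bound, as the true decay is of order `k ^ (-1 / q)`, but enough for `r ≥ 3`. -/
theorem one_div_two_mul_le_binomCoeff {q : ℕ} (hq : 2 ≤ q) (k : ℕ) :
    1 / (2 * (k + 1 : ℕ) : ℝ) ≤ binomCoeff q (k + 1) := by
  have h2 : (2 : ℝ) ≤ q := by exact_mod_cast hq
  induction k with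
  | zero =>
    rw [binomCoeff_succ, binomCoeff, div_le_iff₀ (by positivity)]
    have : (q : ℝ) ≠ 0 := by positivity
    field_simp
    push_cast
    linarith
  | succ k ih =>
    rw [binomCoeff_succ]
    refine le_trans ?_ (mul_le_mul_of_nonneg_right ih ?_)
    · rw [div_mul_div_comm, div_le_div_iff₀ (by positivity) (by positivity)]
      push_cast
      have hk : (0 : ℝ) ≤ k := by positivity
      nlinarith [mul_nonneg hk hk, mul_nonneg (sub_nonneg.2 h2) hk]
    · apply div_nonneg _ (by positivity)
      have : (1 : ℝ) ≤ (k + 1 + 1 : ℕ) := by exact_mod_cast Nat.succ_pos _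
      nlinarith

/-- For `r = 2` the previous bound is too weak at odd indices. This one, proved in steps of two, is
sharp at `k = 0`, the source of the exceptional equality. -/
theorem one_div_two_mul_le_binomCoeff_two (k : ℕ) :
    1 / (2 * (k + 1 : ℕ) : ℝ) ≤ binomCoeff 2 (2 * k + 1) := by
  induction k with
  | zero => norm_num [binomCoeff]
  | succ k ih =>
    rw [show 2 * (k + 1) + 1 = 2 * k + 1 + 1 + 1 by ring, binomCoeff_succ, binomCoeff_succ,
      mul_assoc]
    have hk : (0 : ℝ) ≤ k := by positivity
    refine le_trans ?_ (mul_le_mul_of_nonneg_right ih ?_)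
    · rw [div_mul_div_comm, div_mul_div_comm, div_le_div_iff₀ (by positivity) (by positivity)]
      push_cast
      nlinarith [mul_nonneg hk hk, mul_nonneg hk (mul_nonneg hk hk)]
    · push_cast
      apply mul_nonneg <;> apply div_nonneg <;> nlinarith

theorem div_pow_lt_binomCoeff {q r : ℕ} (hq : 2 ≤ q) (hr : 3 ≤ r) {j : ℕ} (hj : 1 ≤ j) :
    (q * j : ℝ) / ((q * j) ^ r * (r - 1).factorial) < binomCoeff q (r * j - 1) := by
  obtain ⟨ρ, rfl⟩ : ∃ ρ, r = ρ + 3 := ⟨r - 3, by omega⟩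
  obtain ⟨i, rfl⟩ : ∃ i, j = i + 1 := ⟨j - 1, by omega⟩
  have hk : (ρ + 3) * (i + 1) - 1 = (ρ * i + ρ + 3 * i + 1) + 1 := by
    have : (ρ + 3) * (i + 1) = ρ * i + ρ + 3 * i + 3 := by ring
    omega
  rw [hk]
  refine lt_of_lt_of_le ?_ (one_div_two_mul_le_binomCoeff hq _)
  have hx : 2 * (i + 1) ≤ q * (i + 1) := Nat.mul_le_mul_right _ hq
  have h1 : (q * (i + 1)) ^ 2 ≤ (q * (i + 1)) ^ (ρ + 2) :=
    Nat.pow_le_pow_right (by omega) (by omega)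
  have h2 : (2 * (i + 1)) ^ 2 ≤ (q * (i + 1)) ^ 2 := Nat.pow_le_pow_left hx 2
  have h3 : ρ + 2 ≤ (ρ + 2).factorial := Nat.self_le_factorial _
  have h4 : 2 * ((ρ * i + ρ + 3 * i + 1) + 1) < (q * (i + 1)) ^ (ρ + 2) * (ρ + 2).factorial := by
    refine lt_of_lt_of_le ?_ (Nat.mul_le_mul (h2.trans h1) h3)
    nlinarith [Nat.zero_le (i * i), Nat.zero_le (ρ * i * i), Nat.zero_le (ρ * i)]
  have h4' : (2 * ((ρ * i + ρ + 3 * i + 1) + 1 : ℕ) : ℝ) <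
      (q * (i + 1 : ℕ)) ^ (ρ + 2) * (ρ + 2).factorial := by exact_mod_cast h4
  have hpos : (0 : ℝ) < q * (i + 1 : ℕ) := by positivity
  rw [show ρ + 3 - 1 = ρ + 2 by omega, div_lt_div_iff₀ (by positivity) (by positivity)]
  calc (q * (i + 1 : ℕ) : ℝ) * (2 * ((ρ * i + ρ + 3 * i + 1) + 1 : ℕ))
      < q * (i + 1 : ℕ) * ((q * (i + 1 : ℕ)) ^ (ρ + 2) * (ρ + 2).factorial) :=
        mul_lt_mul_of_pos_left h4' hpos
    _ = _ := by ring

theorem div_pow_le_binomCoeff_two {j : ℕ} (hj : 1 ≤ j) :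
    ((2 : ℕ) * j : ℝ) / (((2 : ℕ) * j) ^ 2 * (2 - 1).factorial) ≤ binomCoeff 2 (2 * j - 1) := by
  obtain ⟨i, rfl⟩ : ∃ i, j = i + 1 := ⟨j - 1, by omega⟩
  refine le_trans (le_of_eq ?_) (one_div_two_mul_le_binomCoeff_two i)
  have : ((i + 1 : ℕ) : ℝ) ≠ 0 := by positivity
  rw [show 2 - 1 = 1 by norm_num, Nat.factorial_one]
  push_cast at *
  field_simp

/-- The comparison of the new mass `fullProb` at `q * r * s` with the decrease of the binomial
coefficients. -/
theorem fullProb_le_sum {q r : ℕ} (hq : 2 ≤ q) (hr : 2 ≤ r)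
    (H : ∀ j : ℕ, 1 ≤ j →
      (q * j : ℝ) / ((q * j) ^ r * (r - 1).factorial) ≤ binomCoeff q (r * j - 1))
    {s : ℕ} (hs : 1 ≤ s) :
    fullProb q r (q * r * s) ≤ ∑ j ∈ Finset.Icc 1 s,
        fullProb q r (q * r * (s - j)) * (binomCoeff q (r * j - 1) / (q * r * j)) ∧
    ((2 ≤ s ∨ (q : ℝ) / (q ^ r * (r - 1).factorial) < binomCoeff q (r - 1)) →
      fullProb q r (q * r * s) < ∑ j ∈ Finset.Icc 1 s,
        fullProb q r (q * r * (s - j)) * (binomCoeff q (r * j - 1) / (q * r * j))) := by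
  have hq0 : (0 : ℝ) < q := by positivity
  have hr0 : (0 : ℝ) < r := by positivity
  have hs0 : (0 : ℝ) < s := by positivity
  have hM : (0 : ℝ) < q * r * s := by positivity
  have hrec := mul_fullProb_mul_le (q := q) (r := r) (by omega) (by omega) s
  rw [mul_comm, ← le_div_iff₀ hM, Finset.sum_div] at hrec
  have hterm : ∀ j ∈ Finset.Icc 1 s,
      (q * j : ℝ) / ((q * j) ^ r * (r - 1).factorial) * fullProb q r (q * r * (s - j)) /
        (q * r * s) ≤
      fullProb q r (q * r * (s - j)) * (binomCoeff q (r * j - 1) / (q * r * j)) := by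
    intro j hj
    have hj := Finset.mem_Icc.1 hj
    have hj0 : (0 : ℝ) < j := by exact_mod_cast hj.1
    have hjs : (j : ℝ) ≤ s := by exact_mod_cast hj.2
    have hd := (fullProb_mul_pos (q := q) (r := r) (by omega) (s - j)).le
    have hu := (binomCoeff_pos hq (r * j - 1)).le
    rw [mul_comm, mul_div_assoc]
    apply mul_le_mul_of_nonneg_left _ hd
    exact div_le_div₀ hu (H j hj.1) (by positivity) (by gcongr)
  refine ⟨hrec.trans (Finset.sum_le_sum hterm), fun h => hrec.trans_lt
    (Finset.sum_lt_sum hterm ⟨1, Finset.mem_Icc.2 ⟨le_rfl, hs⟩, ?_⟩)⟩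
  have hd := fullProb_mul_pos (q := q) (r := r) (by omega) (s - 1)
  have hu := binomCoeff_pos hq (r - 1)
  have H1 := H 1 le_rfl
  rw [mul_comm, mul_div_assoc]
  apply mul_lt_mul_of_pos_left _ hd
  simp only [Nat.cast_one, mul_one] at H1 ⊢
  -- Strictness comes from the term `j = 1`: either the denominator `q * r * s` exceeds `q * r`, or
  -- the weights themselves compare strictly.
  rcases h with h | h
  · have hs1 : (1 : ℝ) < s := by exact_mod_cast h
    refine (div_le_div_of_nonneg_right H1 hM.le).trans_lt
      (div_lt_div_of_pos_left hu (by positivity) ?_)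
    exact lt_mul_of_one_lt_right (by positivity) hs1
  · have hs1 : (1 : ℝ) ≤ s := by exact_mod_cast hs
    refine (div_lt_div_of_pos_right h hM).trans_le
      (div_le_div_of_nonneg_left hu.le (by positivity) ?_)
    exact le_mul_of_one_le_right (by positivity) hs1

/-- The general upper bound and the contribution of the partition `2 + 2` coincide here. -/
theorem fullProb_two_two_four : fullProb 2 2 (2 * 2 * 1) = 1 / 8 := by
  apply le_antisymm
  · refine (fullProb_le_sum le_rfl le_rfl (fun j hj => div_pow_le_binomCoeff_two hj)
      le_rfl).1.trans (le_of_eq ?_)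
    rw [Finset.Icc_self, Finset.sum_singleton, Nat.sub_self, Nat.mul_zero, fullProb,
      coeff_zero_genFun]
    norm_num [binomCoeff]
  · have h := one_div_le_fullProb_mul (q := 2) (r := 2) (by norm_num) 1
    norm_num [Nat.factorial] at h ⊢
    exact h

/-! ### Case (ii): `q * r` divides `n + 1` -/

theorem binomCoeff_pred_sub {q k : ℕ} (hq : 0 < q) (hk : 1 ≤ k) :
    binomCoeff q (k - 1) - binomCoeff q k = binomCoeff q (k - 1) / (q * k) := by
  obtain ⟨i, rfl⟩ : ∃ i, k = i + 1 := ⟨k - 1, by omega⟩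
  have : (q : ℝ) ≠ 0 := by positivity
  have : ((i + 1 : ℕ) : ℝ) ≠ 0 := by positivity
  rw [binomCoeff_succ, Nat.add_sub_cancel]
  field_simp
  ring

/-- The difference of the root probabilities around a multiple of `q * r`. -/
theorem rootProb_sub_rootProb_succ {q l : ℕ} (hq : q.Prime) (hl : 1 ≤ l) {n s : ℕ}
    (hn : n + 1 = q * q ^ l * s) :
    rootProb (q ^ l) n - rootProb (q ^ l) (n + 1) =
      (∑ j ∈ Finset.Icc 1 s, fullProb q (q ^ l) (q * q ^ l * (s - j)) *
        (binomCoeff q (q ^ l * j - 1) / (q * (q ^ l : ℕ) * j))) -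
        fullProb q (q ^ l) (q * q ^ l * s) := by
  rw [rootProb_eq_sum hq hl, rootProb_eq_sum hq hl]
  set r := q ^ l with hr_def
  have hr : 0 < r := pow_pos hq.pos l
  have hM : 0 < q * r := Nat.mul_pos hq.pos hr
  have e1 : (n + 1) / (q * r) = s := by rw [hn, Nat.mul_div_cancel_left _ hM]
  have e2 : (n + 1) / q = r * s := by rw [hn, mul_assoc, Nat.mul_div_cancel_left _ hq.pos]
  have e3 : n / q = r * s - 1 := by
    have h := Nat.succ_div (a := n) (b := q)
    rw [if_pos (by rw [hn, mul_assoc]; exact dvd_mul_right _ _), e2] at h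
    exact (Nat.sub_eq_of_eq_add h).symm
  have e4 : n / (q * r) + 1 = s := by
    have h := Nat.succ_div (a := n) (b := q * r)
    rw [if_pos (by rw [hn]; exact dvd_mul_right _ _), e1] at h
    omega
  -- The last summand for `n + 1` is `d s * u 0` and has no partner in the sum for `n`; the others
  -- are paired and reindexed by `j = s - i`.
  rw [e1, e2, e3, e4, Finset.sum_range_succ, Nat.sub_self, binomCoeff, mul_one, ← sub_sub,
    ← Finset.sum_sub_distrib]
  congr 1
  refine Finset.sum_bij' (fun i _ => s - i) (fun j _ => s - j) ?_ ?_ ?_ ?_ ?_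
  · intro i hi
    have := Finset.mem_range.1 hi
    exact Finset.mem_Icc.2 (by omega)
  · intro j hj
    have := Finset.mem_Icc.1 hj
    exact Finset.mem_range.2 (by omega)
  · intro i hi
    have := Finset.mem_range.1 hi
    omega
  · intro j hj
    have := Finset.mem_Icc.1 hj
    omega
  · intro i hi
    have hi := Finset.mem_range.1 hi
    have hk : 1 ≤ r * (s - i) := Nat.mul_pos hr (by omega)
    have h1 : r * s - r * i = r * (s - i) := (Nat.mul_sub _ _ _).symm
    rw [Nat.sub_right_comm, h1, Nat.sub_sub_self hi.le, ← mul_sub,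
      binomCoeff_pred_sub hq.pos hk]
    push_cast
    ring

theorem rootProb_ge_of_mul_dvd {q l n : ℕ} (hq : q.Prime) (hl : 1 ≤ l)
    (h : q * q ^ l ∣ n + 1) :
    rootProb (q ^ l) n ≥ rootProb (q ^ l) (n + 1) ∧
      (rootProb (q ^ l) n = rootProb (q ^ l) (n + 1) ↔ q ^ l = 2 ∧ n = 3) := by
  obtain ⟨s, hs⟩ := h
  have hs1 : 1 ≤ s := Nat.pos_of_ne_zero (by rintro rfl; omega)
  have hdiff := rootProb_sub_rootProb_succ hq hl hs
  have hr2 : 2 ≤ q ^ l := hq.two_le.trans (Nat.le_self_pow (by omega) q)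
  rcases hr2.eq_or_lt with hr | hr
  · have hq2 : q = 2 := by
      have h1 : q ≤ q ^ l := Nat.le_self_pow (by omega) q
      have := hq.two_le
      omega
    subst hq2
    rw [← hr] at hdiff hs ⊢
    have hle := fullProb_le_sum le_rfl le_rfl (fun j hj => div_pow_le_binomCoeff_two hj) hs1
    refine ⟨by linarith [hle.1], fun heq => ⟨rfl, ?_⟩, ?_⟩
    · by_contra hn
      -- From `n + 1 = 4 * s` and `n ≠ 3` follows `s ≥ 2`.
      have := hle.2 (Or.inl (by omega))
      linarith
    · rintro ⟨_, rfl⟩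
      obtain rfl : s = 1 := by omega
      rw [Finset.Icc_self, Finset.sum_singleton, Nat.sub_self, Nat.mul_zero, fullProb,
        coeff_zero_genFun, fullProb_two_two_four] at hdiff
      norm_num [binomCoeff] at hdiff ⊢
      linarith
  · have hlt := (fullProb_le_sum hq.two_le hr2
      (fun j hj => (div_pow_lt_binomCoeff hq.two_le hr hj).le) hs1).2
      (Or.inr (by simpa using div_pow_lt_binomCoeff hq.two_le hr le_rfl))
    refine ⟨by linarith, fun heq => ?_, fun h => ?_⟩
    · linarith
    · omega

/-! ### Case (i): `q` but not `q * r` divides `n + 1` -/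

theorem rootProb_ge_of_dvd_of_not_mul_dvd {q l n : ℕ} (hq : q.Prime) (hl : 1 ≤ l)
    (h : q ∣ n + 1) (h' : ¬ q * q ^ l ∣ n + 1) :
    rootProb (q ^ l) n ≥ ((n : ℝ) + 1) / (n : ℝ) * rootProb (q ^ l) (n + 1) ∧
      (rootProb (q ^ l) n = ((n : ℝ) + 1) / (n : ℝ) * rootProb (q ^ l) (n + 1) ↔
        ∃ k : ℕ, 1 ≤ k ∧ k ≤ q ^ l - 1 ∧ n + 1 = k * q) := by
  obtain ⟨m, hm⟩ := h
  rw [rootProb_eq_sum hq hl, rootProb_eq_sum hq hl]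
  set r := q ^ l with hr_def
  have hr : 0 < r := pow_pos hq.pos l
  have hM : 0 < q * r := Nat.mul_pos hq.pos hr
  have hm1 : 1 ≤ m := Nat.pos_of_ne_zero (by rintro rfl; omega)
  have hn1 : 1 ≤ n := by
    have := Nat.mul_le_mul hq.two_le hm1
    omega
  have e1 : (n + 1) / q = m := by rw [hm, Nat.mul_div_cancel_left _ hq.pos]
  have e2 : n / q = m - 1 := by
    have h := Nat.succ_div (a := n) (b := q)
    rw [if_pos (by rw [hm]; exact dvd_mul_right _ _), e1] at h
    omega
  have e3 : n / (q * r) = m / r := by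
    have h := Nat.succ_div (a := n) (b := q * r)
    rw [if_neg h', ← Nat.div_div_eq_div_mul, e1] at h
    omega
  have e4 : (n + 1) / (q * r) = m / r := by rw [← Nat.div_div_eq_div_mul, e1]
  have hrm : ¬ r ∣ m := fun hd => h' (by rw [hm]; exact mul_dvd_mul_left q hd)
  rw [e1, e2, e3, e4, Finset.mul_sum]
  have hn0 : (0 : ℝ) < n := by exact_mod_cast hn1
  have hnR : (n : ℝ) + 1 = q * m := by exact_mod_cast hm
  have hlt : ∀ i ∈ Finset.range (m / r + 1), r * i < m := by
    intro i hi
    have h1 := (Nat.le_div_iff_mul_le hr).1 (Nat.lt_succ_iff.1 (Finset.mem_range.1 hi))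
    rw [mul_comm] at h1
    exact lt_of_le_of_ne h1 (fun h => hrm ⟨i, h.symm⟩)
  have hq0 : (0 : ℝ) < q := by exact_mod_cast hq.pos
  -- With `K = m - r * i`, the ratio `u K / u (K - 1)` is `(q * K - 1) / (q * K)`, while `(n + 1) /
  -- n = q * m / (q * m - 1)`; the product falls short of `1` by `(m - K) / (n * K)`.
  have hterm : ∀ i ∈ Finset.range (m / r + 1),
      fullProb q r (q * r * i) * binomCoeff q (m - 1 - r * i) -
        ((n : ℝ) + 1) / n * (fullProb q r (q * r * i) * binomCoeff q (m - r * i)) =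
      fullProb q r (q * r * i) * binomCoeff q (m - 1 - r * i) *
        ((r * i : ℕ) / (n * (m - r * i : ℕ))) := by
    intro i hi
    have hi := hlt i hi
    obtain ⟨k, hk⟩ : ∃ k, m - r * i = k + 1 := ⟨m - r * i - 1, by omega⟩
    have hk' : m - 1 - r * i = k := by omega
    have hmk : m = k + 1 + r * i := by omega
    have hk0 : ((k + 1 : ℕ) : ℝ) ≠ 0 := by positivity
    rw [hk, hk', binomCoeff_succ, hnR]
    have hnk : (n : ℝ) = q * ((k + 1 : ℕ) + (r * i : ℕ)) - 1 := by
      have : (m : ℝ) = (k + 1 : ℕ) + (r * i : ℕ) := by exact_mod_cast hmk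
      rw [← this]; linarith
    have hmR : (m : ℝ) = (k + 1 : ℕ) + (r * i : ℕ) := by exact_mod_cast hmk
    rw [hmR]
    generalize ((k + 1 : ℕ) : ℝ) = K at *
    generalize ((r * i : ℕ) : ℝ) = A at *
    field_simp
    rw [hnk]
    ring
  have hnonneg : ∀ i ∈ Finset.range (m / r + 1),
      ((n : ℝ) + 1) / n * (fullProb q r (q * r * i) * binomCoeff q (m - r * i)) ≤
      fullProb q r (q * r * i) * binomCoeff q (m - 1 - r * i) := by
    intro i hi
    rw [← sub_nonneg, hterm i hi]
    have := fullProb_mul_pos (q := q) (r := r) hq.pos i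
    have := binomCoeff_pos hq.two_le (m - 1 - r * i)
    positivity
  refine ⟨Finset.sum_le_sum hnonneg, ?_⟩
  have hiff : (∃ k : ℕ, 1 ≤ k ∧ k ≤ r - 1 ∧ n + 1 = k * q) ↔ m < r := by
    constructor
    · rintro ⟨k, _, hk, hkn⟩
      have : k = m := Nat.eq_of_mul_eq_mul_left hq.pos (by rw [← hm, hkn, mul_comm])
      omega
    · intro h
      exact ⟨m, hm1, by omega, by rw [hm, mul_comm]⟩
  rw [hiff]
  constructor
  · intro heq
    by_contra hmr
    -- Once `m ≥ r`, the index `i = 1` occurs and its difference is strictly positive.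
    have hd : 1 ≤ m / r := (Nat.one_le_div_iff hr).2 (not_lt.1 hmr)
    refine (Finset.sum_lt_sum hnonneg ⟨1, Finset.mem_range.2 (by omega), ?_⟩).ne' heq
    have h1 : 1 ∈ Finset.range (m / r + 1) := Finset.mem_range.2 (by omega)
    rw [← sub_pos, hterm 1 h1]
    have := fullProb_mul_pos (q := q) (r := r) hq.pos 1
    have := binomCoeff_pos hq.two_le (m - 1 - r * 1)
    have h2 : 0 < m - r * 1 := Nat.sub_pos_of_lt (hlt 1 h1)
    positivity
  · intro h
    apply Finset.sum_congr rfl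
    intro i hi
    rw [← sub_eq_zero, hterm i hi]
    rw [Nat.div_eq_of_lt h, Finset.mem_range] at hi
    obtain rfl : i = 0 := by omega
    simp

theorem mainTheorem4 (q l r n : ℕ) (hq : q.Prime) (hl : 1 ≤ l) (hr : r = q ^ l) :
    (q ∣ n + 1 → ¬ q * r ∣ n + 1 →
      rootProb r n ≥ ((n : ℝ) + 1) / (n : ℝ) * rootProb r (n + 1) ∧
      (rootProb r n = ((n : ℝ) + 1) / (n : ℝ) * rootProb r (n + 1) ↔
        ∃ k : ℕ, 1 ≤ k ∧ k ≤ r - 1 ∧ n + 1 = k * q)) ∧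
    (q * r ∣ n + 1 →
      rootProb r n ≥ rootProb r (n + 1) ∧
      (rootProb r n = rootProb r (n + 1) ↔ r = 2 ∧ n = 3)) := by
  subst hr
  exact ⟨rootProb_ge_of_dvd_of_not_mul_dvd hq hl, rootProb_ge_of_mul_dvd hq hl⟩
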